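/- All graphs are finite, connected and loopless, with multiple edges allowed. A vertex cut of $G$ is a set $S\subsetneq V(G)$ whose removal leaves a disconnected graph or a graph on a single vertex; an edge cut is a sub-multiset of $E(G)$ whose removal leaves a disconnected graph or a graph on a single vertex. Let $\kappa(G)$ and $\lambda(G)$ be the smallest sizes of a vertex cut and of an edge cut. Let $\mathrm{gon}(G)$ be the smallest degree of a divisor (a $\mathbb Z$-valued function on $V(G)$) of positive rank, with rank taken with respect to chip-firing equivalence. A scramble on $G$ is a collection $\mathcal S$ of nonempty connected vertex sets (eggs). Its order is the largest $r$ such that every set meeting all eggs has at least $r$ vertices, and $|E(A,A^c)|\ge r$ whenever $A$ and $A^c$ each contain an egg. Let $\mathrm{sn}(G)$ be the largest order of a scramble on $G$. Let $G\square H$ denote the Cartesian product. **Theorem.** Let $G$ and $H$ be graphs with $$\kappa(G)=\lambda(G)=\mathrm{gon}(G)=k\le\lambda(H),\qquad |V(H)|\le |V(G)|-2k+4,\qquad |V(G)|\ge 2k-1,$$ and, in the case $k=1$, suppose also that $|V(H)|\le \lambda(H)\,|V(G)|$. Then $$\mathrm{sn}(G\square H)=\mathrm{gon}(G\square H)=k\,|V(H)|.$$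 In particular, if $T$ is a tree with $m\ge 2$ vertices and $k\ge 1$, $\ell$ are integers with $k<\ell\le k(m-2)+4$, then $$\mathrm{sn}(K_\ell\square K_k\square T)=\mathrm{gon}(K_\ell\square K_k\square T)=k\ell .$$ -/

import Mathlib

/-- A loopless multigraph on the vertex set `V`: its edge multiset is recorded by the number
`mult u v` of edges joining `u` and `v`. (Finiteness of the graph is finiteness of `V`.) -/
@[ext]
structure Multigraph (V : Type*) where
  mult : V → V → ℕ
  symm : ∀ u v, mult u v = mult v u
  loopless : ∀ v, mult v v = 0

namespace Multigraph

section Basic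

variable {V W : Type*}

/-- The underlying simple graph: two vertices are adjacent if at least one edge joins them.
It is used only to speak of connectedness. -/
def toSimple (G : Multigraph V) : SimpleGraph V where
  Adj u v := 0 < G.mult u v
  symm := ⟨fun u v h => by rwa [G.symm v u]⟩
  loopless := ⟨fun v h => by simp [G.loopless v] at h⟩

/-- A connected graph (in particular, it has a vertex). -/
def Connected (G : Multigraph V) : Prop := G.toSimple.Connected

/-- A nonempty vertex set inducing a connected subgraph. -/
def ConnectedSubset (G : Multigraph V) (S : Finset V) : Prop :=
  (G.toSimple.induce (S : Set V)).Connected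

/-- A tree: connected and without cycles, where a pair of parallel edges counts as a cycle. -/
def IsTree (G : Multigraph V) : Prop :=
  G.toSimple.IsTree ∧ ∀ u v, G.mult u v ≤ 1

open scoped Classical in
/-- The complete graph on `V`. -/
noncomputable def complete (V : Type*) : Multigraph V where
  mult u v := if u = v then 0 else 1
  symm u v := by simp only [eq_comm]
  loopless v := by simp

open scoped Classical in
/-- The Cartesian product of two multigraphs. -/
noncomputable def boxProd (G : Multigraph V) (H : Multigraph W) : Multigraph (V × W) where
  mult a b :=
    (if a.1 = b.1 then H.mult a.2 b.2 else 0) + (if a.2 = b.2 then G.mult a.1 b.1 else 0)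
  symm a b := by simp only [eq_comm, G.symm a.1 b.1, H.symm a.2 b.2]
  loopless a := by simp [G.loopless, H.loopless]

/-- Removal of the edges of `D` (as a difference of edge multisets). -/
def deleteEdges (G D : Multigraph V) : Multigraph V where
  mult u v := G.mult u v - D.mult u v
  symm u v := by rw [G.symm, D.symm]
  loopless v := by simp [G.loopless]

variable [Fintype V]

open scoped Classical in
/-- The number of edges, counted with multiplicity. -/
noncomputable def numEdges (G : Multigraph V) : ℕ :=
  ∑ e : Sym2 V, Sym2.lift ⟨G.mult, G.symm⟩ e

/-- The valence of a vertex. -/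
def valence (G : Multigraph V) (v : V) : ℕ := ∑ u, G.mult v u

/-- The number `|E(A, B)|` of edges between two disjoint vertex sets. -/
def edgesBetween (G : Multigraph V) (A B : Finset V) : ℕ := ∑ a ∈ A, ∑ b ∈ B, G.mult a b

/-! ### Connectivity -/

/-- A vertex cut: a proper subset of the vertices whose removal leaves at least two connected
components, or a graph on a single vertex. -/
def IsVertexCut (G : Multigraph V) (S : Finset V) : Prop :=
  S ≠ Finset.univ ∧
    (¬ (G.toSimple.induce ((S : Set V)ᶜ)).Preconnected ∨ S.card + 1 = Fintype.card V)

/-- The vertex-connectivity `κ(G)`: the smallest cardinality of a vertex cut. -/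
noncomputable def vertexConnectivity (G : Multigraph V) : ℕ :=
  sInf {n | ∃ S : Finset V, G.IsVertexCut S ∧ S.card = n}

/-- An edge cut: a sub-multiset `D` of the edges of `G` whose removal leaves a disconnected
graph, or a graph on a single vertex. -/
def IsEdgeCut (G D : Multigraph V) : Prop :=
  (∀ u v, D.mult u v ≤ G.mult u v) ∧
    (¬ (G.deleteEdges D).toSimple.Preconnected ∨ Fintype.card V = 1)

/-- The edge-connectivity `λ(G)`: the smallest cardinality of an edge cut. -/
noncomputable def edgeConnectivity (G : Multigraph V) : ℕ :=
  sInf {n | ∃ D : Multigraph V, G.IsEdgeCut D ∧ D.numEdges = n}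

/-! ### Scrambles -/

/-- A scramble: a collection of nonempty connected vertex sets (its eggs). -/
def IsScramble (G : Multigraph V) (S : Finset (Finset V)) : Prop :=
  ∀ E ∈ S, G.ConnectedSubset E

/-- `C` meets every egg of `S`. -/
def IsHittingSet (S : Finset (Finset V)) (C : Finset V) : Prop :=
  ∀ E ∈ S, ∃ v ∈ E, v ∈ C

open scoped Classical in
/-- `A` separates two eggs of `S`. -/
def IsEggCut (S : Finset (Finset V)) (A : Finset V) : Prop :=
  ∃ E₁ ∈ S, ∃ E₂ ∈ S, E₁ ⊆ A ∧ E₂ ⊆ Aᶜ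

open scoped Classical in
/-- The order of a scramble: the largest `k` such that no set of fewer than `k` vertices is a
hitting set and every egg-cut has size at least `k`. -/
noncomputable def scrambleOrder (G : Multigraph V) (S : Finset (Finset V)) : ℕ :=
  sSup {k | (∀ C : Finset V, C.card < k → ¬ IsHittingSet S C) ∧
    ∀ A : Finset V, IsEggCut S A → k ≤ G.edgesBetween A Aᶜ}

/-- The scramble number `sn(G)`: the largest order of a scramble on `G`. -/
noncomputable def scrambleNumber (G : Multigraph V) : ℕ :=
  sSup {n | ∃ S : Finset (Finset V), G.IsScramble S ∧ G.scrambleOrder S = n}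

/-! ### Divisors and gonality

A divisor is a function `V → ℤ`; it is effective when `0 ≤ D`. -/

/-- The degree of a divisor. -/
def degree (D : V → ℤ) : ℤ := ∑ v, D v

open scoped Classical in
/-- The divisor obtained from `D` by chip-firing the vertex `w`. -/
noncomputable def fire (G : Multigraph V) (w : V) (D : V → ℤ) : V → ℤ :=
  fun v => if v = w then D w - G.valence w else D v + G.mult v w

/-- `D₁ ∼ D₂`: a finite sequence of chip-firing moves leads from `D₁` to `D₂`. -/
def Equivalent (G : Multigraph V) : (V → ℤ) → (V → ℤ) → Prop :=
  Relation.ReflTransGen fun D D' => ∃ w, D' = G.fire w D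

/-- `D` is equivalent to an effective divisor. -/
def EquivEffective (G : Multigraph V) (D : V → ℤ) : Prop :=
  ∃ D' : V → ℤ, 0 ≤ D' ∧ G.Equivalent D D'

open scoped Classical in
/-- The rank of a divisor: `-1` if `D` is not equivalent to an effective divisor, and otherwise
the largest `r` such that `D - E` is equivalent to an effective divisor for every effective `E`
of degree `r`. -/
noncomputable def rank (G : Multigraph V) (D : V → ℤ) : ℤ :=
  if G.EquivEffective D then
    ((sSup {r : ℕ | ∀ E : V → ℤ, 0 ≤ E → degree E = r → G.EquivEffective (D - E)} : ℕ) : ℤ)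
  else -1

/-- The gonality `gon(G)`: the smallest degree of a divisor of positive rank. (A divisor of
positive rank is equivalent to an effective one, so its degree is a natural number.) -/
noncomputable def gonality (G : Multigraph V) : ℕ :=
  sInf {d : ℕ | ∃ D : V → ℤ, 0 < G.rank D ∧ degree D = d}

end Basic

end Multigraph

/-! The upper bound copies an optimal divisor of `G` into every fibre `V × {w}`. A firing script
pulled back from `V` is constant along `H`-edges, so positive rank survives and the degree is `k *
|W|` (`rank_pos_boxProd_fst`, `gonality_boxProd_le`).

The lower bound uses that scramble order never exceeds gonality (`IsScramble.le_degree`) and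
exhibits one scramble, `fibreScramble`: in every fibre, the copies of all complements of `(k -
1)`-sets. These eggs are connected because `k - 1 < κ(G)`. A hitting set needs at least `k` vertices
in each fibre, since fewer would be avoided by some egg there. For an egg-cut `A`, every row and
every column that `A` splits contributes at least `k` boundary edges, because `k` is at most both
edge-connectivities; it remains to count at least `|W|` split rows and columns
(`le_edgesBetween_of_fibres`). For `k = 1` that count can fail, and the columns alone, weighted by
`λ(H)`, suffice.

The corollary takes `K_k □ T` as first factor and `K_ℓ` as second. A leaf of `T` gives a vertex of
valence `k`, bounding both connectivities above. The matching lower bounds are fibre counts, and the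
gonality is `k` because a tree has gonality at most one and the singleton scramble has order at
least `k`. -/

namespace Multigraph

open scoped Classical

variable {V W : Type*}

/-! ### Divisors and the Laplacian -/

section Divisors

variable [Fintype V] (G : Multigraph V)

/-- The Laplacian of `G`: firing every vertex `v` exactly `f v` times turns a divisor `D` into
`D - G.laplacian f`. -/
def laplacian (f : V → ℤ) (v : V) : ℤ := ∑ u, (f v - f u) * G.mult v u

lemma laplacian_add (f g : V → ℤ) : G.laplacian (f + g) = G.laplacian f + G.laplacian g := by
  funext v
  simp only [laplacian, Pi.add_apply, ← Finset.sum_add_distrib]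
  exact Finset.sum_congr rfl fun u _ => by ring

lemma laplacian_sub (f g : V → ℤ) : G.laplacian (f - g) = G.laplacian f - G.laplacian g := by
  funext v
  simp only [laplacian, Pi.sub_apply, ← Finset.sum_sub_distrib]
  exact Finset.sum_congr rfl fun u _ => by ring

lemma laplacian_zero : G.laplacian 0 = 0 := by
  funext v
  simp [laplacian]

lemma laplacian_const (c : ℤ) : G.laplacian (fun _ => c) = 0 := by
  funext v
  simp [laplacian]

lemma degree_laplacian (f : V → ℤ) : degree (G.laplacian f) = 0 := by
  have h : degree (G.laplacian f) = -degree (G.laplacian f) := by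
    simp only [degree, laplacian]
    conv_rhs => rw [Finset.sum_comm]
    simp only [← Finset.sum_neg_distrib]
    refine Finset.sum_congr rfl fun u _ => Finset.sum_congr rfl fun v _ => ?_
    rw [G.symm]
    ring
  omega

lemma degree_sub (D E : V → ℤ) : degree (D - E) = degree D - degree E := by
  simp [degree, Finset.sum_sub_distrib]

lemma degree_single (v : V) (c : ℤ) : degree (Pi.single v c : V → ℤ) = c := by
  simp [degree]

lemma degree_nonneg {D : V → ℤ} (h : 0 ≤ D) : 0 ≤ degree D :=
  Finset.sum_nonneg fun v _ => h v

lemma fire_eq (w : V) (D : V → ℤ) :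
    G.fire w D = D - G.laplacian (Pi.single w 1) := by
  funext v
  by_cases hv : v = w
  · subst hv
    simp only [fire, if_true, Pi.sub_apply, laplacian, valence, Pi.single_eq_same]
    push_cast
    congr 1
    refine Finset.sum_congr rfl fun u _ => ?_
    by_cases hu : u = v
    · subst hu
      simp [G.loopless]
    · simp [hu]
  · simp [fire, laplacian, hv, Pi.single_apply]

/-- Induction on the total number of firings, peeling off one firing at a time; the order is
irrelevant because the Laplacian is additive. -/
lemma equivalent_of_nat (D : V → ℤ) (n : ℕ) :
    ∀ f : V → ℕ, ∑ v, f v = n → G.Equivalent D (D - G.laplacian fun v => (f v : ℤ)) := by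
  induction n with
  | zero =>
    intro f hf
    have : (fun v => (f v : ℤ)) = 0 := by
      funext v
      simpa using (Finset.sum_eq_zero_iff.1 hf) v (Finset.mem_univ v)
    rw [this, laplacian_zero, sub_zero]
    exact Relation.ReflTransGen.refl
  | succ n ih =>
    intro f hf
    obtain ⟨w, -, hw⟩ : ∃ w ∈ Finset.univ, f w ≠ 0 :=
      Finset.exists_ne_zero_of_sum_ne_zero (by omega)
    have hfw : f = (f - Pi.single w 1) + Pi.single w 1 := by
      funext v
      by_cases hv : v = w
      · subst hv
        simp
        omega
      · simp [hv]
    have hsum : ∑ v, (f - Pi.single w 1 : V → ℕ) v = n := by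
      rw [hfw] at hf
      simp only [Pi.add_apply, Finset.sum_add_distrib, Finset.sum_pi_single', Finset.mem_univ,
        if_true] at hf
      omega
    refine (ih _ hsum).tail ⟨w, ?_⟩
    rw [fire_eq, sub_sub, ← laplacian_add]
    congr 2
    funext v
    conv_lhs => rw [hfw]
    by_cases hv : v = w
    · subst hv
      simp
    · simp [hv]

lemma equivalent_iff {D D' : V → ℤ} :
    G.Equivalent D D' ↔ ∃ f : V → ℤ, D' = D - G.laplacian f := by
  constructor
  · intro h
    induction h with
    | refl => exact ⟨0, by simp [laplacian_zero]⟩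
    | tail _ h ih =>
      obtain ⟨f, rfl⟩ := ih
      obtain ⟨w, rfl⟩ := h
      exact ⟨f + Pi.single w 1, by rw [fire_eq, laplacian_add, sub_sub]⟩
  · rintro ⟨f, rfl⟩
    -- Constants lie in the kernel of the Laplacian, so an integer script may be shifted until it is
    -- nonnegative and hence realised by actual moves.
    let c : ℤ := ∑ v, |f v|
    have hc : ∀ v, 0 ≤ f v + c := fun v => by
      have h1 : |f v| ≤ c :=
        Finset.single_le_sum (f := fun v => |f v|) (fun i _ => abs_nonneg _) (Finset.mem_univ v)
      have h2 := neg_abs_le (f v)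
      omega
    have h := G.equivalent_of_nat D _ (fun v => (f v + c).toNat) rfl
    have hf : (fun v => (((f v + c).toNat : ℕ) : ℤ)) = f + fun _ => c := by
      funext v
      simp [hc v]
    rwa [hf, laplacian_add, laplacian_const, add_zero] at h

lemma rank_pos_iff [Nonempty V] {D : V → ℤ} :
    0 < G.rank D ↔ ∀ v, ∃ f : V → ℤ, 0 ≤ D - G.laplacian f ∧ 0 < (D - G.laplacian f) v := by
  constructor
  · intro h v
    unfold rank at h
    split_ifs at h with h0
    swap
    · omega
    set R : Set ℕ :=
      {r : ℕ | ∀ E : V → ℤ, 0 ≤ E → degree E = r → G.EquivEffective (D - E)} with hR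
    -- On `ℕ` the supremum of an empty or unbounded set is `0`, so positivity forces `R` to be
    -- nonempty and bounded, and its supremum is attained.
    have hpos : 0 < sSup R := by exact_mod_cast h
    have hne : R.Nonempty := by
      by_contra hne
      rw [Set.not_nonempty_iff_eq_empty.1 hne] at hpos
      simp at hpos
    have hbdd : BddAbove R := by
      by_contra hb
      rw [Nat.sSup_of_not_bddAbove hb] at hpos
      exact lt_irrefl _ hpos
    have hmem := Nat.sSup_mem hne hbdd
    set r := sSup R
    have hs : (0 : V → ℤ) ≤ Pi.single v (r : ℤ) := Pi.single_nonneg.2 (by positivity)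
    obtain ⟨D', hD', he⟩ := hmem (Pi.single v (r : ℤ)) hs (degree_single v _)
    obtain ⟨f, rfl⟩ := G.equivalent_iff.1 he
    refine ⟨f, fun u => ?_, ?_⟩
    · have h1 := hD' u
      have h2 := hs u
      simp only [Pi.sub_apply, Pi.zero_apply] at *
      omega
    · have h1 := hD' v
      simp only [Pi.sub_apply, Pi.zero_apply, Pi.single_eq_same] at *
      omega
  · intro h
    have hD : G.EquivEffective D := by
      obtain ⟨f, hf, -⟩ := h (Classical.arbitrary V)
      exact ⟨_, hf, G.equivalent_iff.2 ⟨f, rfl⟩⟩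
    rw [rank, if_pos hD]
    -- Removing `r` chips at one vertex shows `r ≤ degree D`; without such a bound the supremum
    -- would default to `0`.
    have hbdd : BddAbove
        {r : ℕ | ∀ E : V → ℤ, 0 ≤ E → degree E = r → G.EquivEffective (D - E)} := by
      refine ⟨(degree D).toNat, fun r hr => ?_⟩
      obtain ⟨D', hD', he⟩ := hr (Pi.single (Classical.arbitrary V) (r : ℤ))
        (Pi.single_nonneg.2 (by positivity)) (degree_single _ _)
      obtain ⟨f, rfl⟩ := G.equivalent_iff.1 he
      have := degree_nonneg hD'
      rw [degree_sub, degree_sub, degree_laplacian, degree_single] at this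
      omega
    have hone : 1 ∈ {r : ℕ | ∀ E : V → ℤ, 0 ≤ E → degree E = r → G.EquivEffective (D - E)} := by
      intro E hE hdeg
      obtain ⟨v, -, hv⟩ : ∃ v ∈ Finset.univ, E v ≠ 0 :=
        Finset.exists_ne_zero_of_sum_ne_zero (by rw [degree] at hdeg; simp [hdeg])
      have hle : ∀ u, E u ≤ (Pi.single v 1 : V → ℤ) u := by
        intro u
        by_cases hu : u = v
        · subst hu
          have := Finset.single_le_sum (fun i _ => hE i) (Finset.mem_univ u)
          simp only [degree] at hdeg
          simp
          omega
        · have h1 : E u + E v ≤ degree E := by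
            rw [degree, ← Finset.sum_pair hu]
            exact Finset.sum_le_sum_of_subset_of_nonneg (Finset.subset_univ _) fun i _ _ => hE i
          have h2 := hE v
          simp only [Pi.zero_apply] at h2
          simp [hu]
          omega
      obtain ⟨f, hf, hfv⟩ := h v
      refine ⟨D - E - G.laplacian f, fun u => ?_, G.equivalent_iff.2 ⟨f, rfl⟩⟩
      have h1 := hf u
      have h2 := hle u
      by_cases hu : u = v
      · subst hu
        simp only [Pi.sub_apply, Pi.zero_apply, Pi.single_eq_same] at *
        omega
      · simp only [Pi.sub_apply, Pi.zero_apply, Pi.single_eq_of_ne hu] at *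
        omega
    have := le_csSup hbdd hone
    exact_mod_cast this

lemma degree_nonneg_of_rank_pos [Nonempty V] {D : V → ℤ} (h : 0 < G.rank D) : 0 ≤ degree D := by
  obtain ⟨f, hf, -⟩ := G.rank_pos_iff.1 h (Classical.arbitrary V)
  have := degree_nonneg hf
  rwa [degree_sub, degree_laplacian, sub_zero] at this

lemma gonality_le [Nonempty V] {D : V → ℤ} (h : 0 < G.rank D) : (G.gonality : ℤ) ≤ degree D := by
  have h0 := G.degree_nonneg_of_rank_pos h
  have : G.gonality ≤ (degree D).toNat := Nat.sInf_le ⟨D, h, by simp [h0]⟩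
  omega

lemma exists_rank_pos_degree_eq_gonality [Nonempty V] :
    ∃ D : V → ℤ, 0 < G.rank D ∧ degree D = G.gonality := by
  refine Nat.sInf_mem (s := {d : ℕ | ∃ D : V → ℤ, 0 < G.rank D ∧ degree D = d})
    ⟨Fintype.card V, fun _ => 1, ?_, by simp [degree]⟩
  exact G.rank_pos_iff.2 fun v => ⟨0, by rw [laplacian_zero]; intro u; simp,
    by simp [laplacian_zero]⟩

end Divisors

/-! ### Firing a set of vertices -/

section SetFiring

lemma ConnectedSubset.exists_mult_pos {G : Multigraph V} {E U : Finset V} (hE : G.ConnectedSubset E) {x y : V}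
    (hx : x ∈ E) (hxU : x ∈ U) (hy : y ∈ E) (hyU : y ∉ U) :
    ∃ a ∈ E, ∃ b ∈ E, a ∈ U ∧ b ∉ U ∧ 0 < G.mult a b := by
  obtain ⟨p⟩ := hE.preconnected ⟨x, hx⟩ ⟨y, hy⟩
  obtain ⟨d, -, hd1, hd2⟩ := p.exists_boundary_dart {z | (z : V) ∈ U} hxU hyU
  exact ⟨d.fst, d.fst.2, d.snd, d.snd.2, hd1, hd2, d.adj⟩

variable [Fintype V] (G : Multigraph V)

/-- The indicator function of `U`, as a firing script. -/
noncomputable def indicator (U : Finset V) (v : V) : ℤ := if v ∈ U then 1 else 0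

lemma laplacian_indicator_of_mem {U : Finset V} {v : V} (hv : v ∈ U) :
    G.laplacian (indicator U) v = ∑ u ∈ Uᶜ, (G.mult v u : ℤ) := by
  have : ∀ u, (indicator U v - indicator U u) * (G.mult v u : ℤ) =
      if u ∈ Uᶜ then (G.mult v u : ℤ) else 0 := fun u => by
    by_cases hu : u ∈ U <;> simp [indicator, hv, hu]
  simp only [laplacian, this, Finset.sum_ite_mem, Finset.univ_inter]

lemma laplacian_indicator_compl (U : Finset V) :
    G.laplacian (indicator Uᶜ) = -G.laplacian (indicator U) := by
  have : indicator Uᶜ = (fun _ => 1) - indicator U := by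
    funext v
    by_cases hv : v ∈ U <;> simp [indicator, hv]
  rw [this, laplacian_sub, laplacian_const, zero_sub]

variable {G}

/-- A vertex that gains its first chip is not fired. If `E` also met `U`, an edge inside `E` would
leave `U` at a chipless vertex, which firing would put into debt. -/
lemma ConnectedSubset.subset_compl_of_fire {E U : Finset V} (hE : G.ConnectedSubset E)
    {D : V → ℤ} (hD' : 0 ≤ D - G.laplacian (indicator U)) (h0 : ∀ v ∈ E, ¬ 0 < D v)
    (h1 : ∃ v ∈ E, 0 < (D - G.laplacian (indicator U)) v) : E ⊆ Uᶜ := by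
  obtain ⟨y, hy, hyD⟩ := h1
  have hyU : y ∉ U := fun hyU => by
    have h2 := h0 y hy
    have h3 : (0 : ℤ) ≤ ∑ u ∈ Uᶜ, (G.mult y u : ℤ) := Finset.sum_nonneg fun _ _ => by positivity
    rw [Pi.sub_apply, G.laplacian_indicator_of_mem hyU] at hyD
    linarith
  intro x hx
  rw [Finset.mem_compl]
  intro hxU
  obtain ⟨a, ha, b, -, haU, hbU, hab⟩ := hE.exists_mult_pos hx hxU hy hyU
  have h2 := h0 a ha
  have h3 : 0 ≤ (D - G.laplacian (indicator U)) a := hD' a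
  have h4 : (G.mult a b : ℤ) ≤ ∑ u ∈ Uᶜ, (G.mult a u : ℤ) :=
    Finset.single_le_sum (f := fun u => (G.mult a u : ℤ)) (fun _ _ => by positivity)
      (Finset.mem_compl.2 hbU)
  rw [Pi.sub_apply, G.laplacian_indicator_of_mem haU] at h3
  omega

/-- The time reversal of `subset_compl_of_fire`: firing `Uᶜ` undoes firing `U`. -/
lemma ConnectedSubset.subset_of_fire {E U : Finset V} (hE : G.ConnectedSubset E)
    {D : V → ℤ} (hD : 0 ≤ D) (h0 : ∃ v ∈ E, 0 < D v)
    (h1 : ∀ v ∈ E, ¬ 0 < (D - G.laplacian (indicator U)) v) : E ⊆ U := by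
  have h : D - G.laplacian (indicator U) - G.laplacian (indicator Uᶜ) = D := by
    rw [laplacian_indicator_compl]
    abel
  simpa using hE.subset_compl_of_fire (U := Uᶜ) (by rwa [h]) h1 (by rwa [h])

/-- Each vertex of `U` sends one chip along every edge leaving `U`, and must own those chips
beforehand. -/
lemma edgesBetween_le_degree {U : Finset V} {D : V → ℤ} (hD : 0 ≤ D)
    (hD' : 0 ≤ D - G.laplacian (indicator U)) : (G.edgesBetween U Uᶜ : ℤ) ≤ degree D := by
  have h1 : (G.edgesBetween U Uᶜ : ℤ) ≤ ∑ v ∈ U, D v := by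
    rw [edgesBetween]
    push_cast
    refine Finset.sum_le_sum fun v hv => ?_
    have : 0 ≤ (D - G.laplacian (indicator U)) v := hD' v
    rw [Pi.sub_apply, G.laplacian_indicator_of_mem hv] at this
    linarith
  exact h1.trans (Finset.sum_le_sum_of_subset_of_nonneg (Finset.subset_univ _) fun i _ _ => hD i)

/-- Firing the superlevel sets of `f` one after the other keeps a divisor effective, if it is
effective at both ends. -/
lemma sub_laplacian_truncation_nonneg {D f : V → ℤ} (hD : 0 ≤ D) (hD' : 0 ≤ D - G.laplacian f)
    (t : ℤ) : 0 ≤ D - G.laplacian (fun v => max (f v - t) 0) := by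
  intro v
  -- Below the threshold `v` is never fired and only gains chips over `D`; above it, `v` holds at
  -- least what it has at the end, after `f`.
  rcases le_total (f v) t with h | h
  · have h1 : G.laplacian (fun v => max (f v - t) 0) v ≤ 0 := by
      refine Finset.sum_nonpos fun u _ => mul_nonpos_of_nonpos_of_nonneg ?_ (by positivity)
      beta_reduce
      rw [max_eq_right (by omega : f v - t ≤ 0)]
      have := le_max_right (f u - t) 0
      omega
    have h2 := hD v
    simp only [Pi.sub_apply, Pi.zero_apply] at *
    omega
  · have h1 : G.laplacian (fun v => max (f v - t) 0) v ≤ G.laplacian f v := by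
      refine Finset.sum_le_sum fun u _ => mul_le_mul_of_nonneg_right ?_ (by positivity)
      beta_reduce
      rw [max_eq_left (by omega : 0 ≤ f v - t)]
      have := le_max_left (f u - t) 0
      omega
    have h2 := hD' v
    simp only [Pi.sub_apply, Pi.zero_apply] at *
    omega

end SetFiring

/-! ### The scramble number is a lower bound for gonality -/

section Scrambles

variable [Fintype V] {G : Multigraph V}

/-- The order of a scramble is at most the degree of any divisor of positive rank. -/
theorem IsScramble.le_degree [Nonempty V] {S : Finset (Finset V)} (hS : G.IsScramble S) {r : ℕ}
    (hhit : ∀ C : Finset V, IsHittingSet S C → r ≤ C.card)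
    (hcut : ∀ A : Finset V, IsEggCut S A → r ≤ G.edgesBetween A Aᶜ)
    {D : V → ℤ} (hD : 0 < G.rank D) : (r : ℤ) ≤ degree D := by
  have hrank := G.rank_pos_iff.1 hD
  let hits (D : V → ℤ) (E : Finset V) : Prop := ∃ v ∈ E, 0 < D v
  let count (f : V → ℤ) : ℕ := (S.filter (hits (D - G.laplacian f))).card
  -- Extremal choice: an effective representative meeting as many eggs as possible. If it meets all
  -- of them, its support is a hitting set.
  obtain ⟨f₀, hf₀, hmax⟩ : ∃ f, 0 ≤ D - G.laplacian f ∧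
      ∀ g, 0 ≤ D - G.laplacian g → count g ≤ count f := by
    obtain ⟨f, hf, hmin⟩ := (measure fun f => S.card - count f).wf.has_min
      {f | 0 ≤ D - G.laplacian f} ⟨_, (hrank (Classical.arbitrary V)).choose_spec.1⟩
    refine ⟨f, hf, fun g hg => ?_⟩
    have h1 := hmin g hg
    have h2 : count g ≤ S.card := Finset.card_filter_le _ _
    have h3 : ¬ (S.card - count g < S.card - count f) := h1
    omega
  set D₀ := D - G.laplacian f₀ with hD₀
  have hdeg : degree D₀ = degree D := by rw [hD₀, degree_sub, degree_laplacian, sub_zero]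
  by_cases hh : ∀ E ∈ S, hits D₀ E
  · have h1 := hhit (Finset.univ.filter fun v => 0 < D₀ v) fun E hE => by
      obtain ⟨v, hv, hp⟩ := hh E hE
      exact ⟨v, hv, by simpa using hp⟩
    have h2 : ((Finset.univ.filter fun v => 0 < D₀ v).card : ℤ) ≤ degree D₀ := by
      rw [Finset.card_filter, degree]
      push_cast
      refine Finset.sum_le_sum fun v _ => ?_
      have := hf₀ v
      simp only [Pi.zero_apply] at this
      split_ifs <;> omega
    omega
  push Not at hh
  obtain ⟨E₀, hE₀, hE₀n⟩ := hh
  obtain ⟨⟨v₀, hv₀⟩⟩ := (hS E₀ hE₀).nonempty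
  obtain ⟨f₁, hf₁, hf₁v⟩ := hrank v₀
  set f := f₁ - f₀ with hf
  have hD₁ : D₀ - G.laplacian f = D - G.laplacian f₁ := by
    rw [hD₀, hf, laplacian_sub]
    abel
  let M : ℕ := ∑ v, (f v).natAbs
  have hM : ∀ v, (f v).natAbs ≤ M := fun v =>
    Finset.single_le_sum (f := fun v => (f v).natAbs) (fun _ _ => Nat.zero_le _)
      (Finset.mem_univ v)
  -- The threshold falls from `M` to `-M`. As `|f| ≤ M`, the script is `0` at `s = 0` and `f + M` at
  -- `s = 2 * M`, so the path ends at the divisor with a chip in `E₀`.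
  let g (s : ℕ) : V → ℤ := fun v => max (f v - ((M : ℤ) - s)) 0
  let Ds (s : ℕ) : V → ℤ := D₀ - G.laplacian (g s)
  have hDs (s : ℕ) : 0 ≤ Ds s :=
    sub_laplacian_truncation_nonneg hf₀ (by rw [hD₁]; exact hf₁) _
  have hDs0 : Ds 0 = D₀ := by
    have : g 0 = 0 := by
      funext v
      have := hM v
      simp only [g, Pi.zero_apply]
      omega
    simp only [Ds, this, laplacian_zero, sub_zero]
  have hDsM : Ds (2 * M) = D - G.laplacian f₁ := by
    have : g (2 * M) = f + fun _ => (M : ℤ) := by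
      funext v
      have := hM v
      simp only [g, Pi.add_apply]
      push_cast
      omega
    simp only [Ds, this, laplacian_add, laplacian_const, add_zero, hD₁]
  let U (s : ℕ) : Finset V := Finset.univ.filter fun v => (M : ℤ) - s ≤ f v
  have hstep (s : ℕ) : Ds (s + 1) = Ds s - G.laplacian (indicator (U s)) := by
    have : g (s + 1) = g s + indicator (U s) := by
      funext v
      simp only [g, indicator, U, Pi.add_apply, Finset.mem_filter, Finset.mem_univ, true_and]
      push_cast
      split_ifs <;> omega
    simp only [Ds, this, laplacian_add]
    abel
  -- Stop at the first moment an egg missed by `D₀` is met; the set fired in that step avoids this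
  -- egg.
  have hex : ∃ s, ∃ E ∈ S, ¬ hits D₀ E ∧ hits (Ds s) E :=
    ⟨2 * M, E₀, hE₀, hE₀n, v₀, hv₀, by rw [hDsM]; exact hf₁v⟩
  obtain ⟨E, hE, hEn, hEh⟩ := Nat.find_spec hex
  have hmin := fun s => Nat.find_min hex (m := s)
  set n := Nat.find hex
  obtain ⟨i, hi⟩ : ∃ i, n = i + 1 := by
    refine Nat.exists_eq_succ_of_ne_zero fun h => hEn ?_
    rwa [h, hDs0] at hEh
  have hEi : ¬ hits (Ds i) E := fun h => hmin i (by omega) ⟨E, hE, hEn, h⟩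
  rw [hi] at hEh
  have hEU : E ⊆ (U i)ᶜ := by
    refine (hS E hE).subset_compl_of_fire (D := Ds i) ?_ ?_ ?_
    · rw [← hstep]
      exact hDs _
    · exact fun v hv h => hEi ⟨v, hv, h⟩
    · rw [← hstep]
      exact hEh
  -- By maximality, gaining `E` must be paid for by losing some `F`. When `F` is first lost it lies
  -- in the set then fired, and the fired sets increase, so `U i` separates `F` from `E`.
  obtain ⟨F, hF, hF0, hFi⟩ : ∃ F ∈ S, hits D₀ F ∧ ¬ hits (Ds (i + 1)) F := by
    by_contra hcon
    push Not at hcon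
    have h1 : S.filter (hits D₀) ⊂ S.filter (hits (Ds (i + 1))) := by
      rw [Finset.ssubset_iff_of_subset]
      · exact ⟨E, by simp [hE, hEh], by simp [hEn]⟩
      · intro F hF
        rw [Finset.mem_filter] at hF ⊢
        exact ⟨hF.1, hcon F hF.1 hF.2⟩
    have h2 : Ds (i + 1) = D - G.laplacian (f₀ + g (i + 1)) := by
      simp only [Ds, hD₀, laplacian_add]
      abel
    have h3 := hmax (f₀ + g (i + 1)) (by rw [← h2]; exact hDs _)
    have h4 := Finset.card_lt_card h1
    simp only [count, ← h2] at h3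
    exact absurd h3 (not_le.2 h4)
  have hexF : ∃ s, ¬ hits (Ds s) F := ⟨i + 1, hFi⟩
  have hjF := Nat.find_spec hexF
  have hjle : Nat.find hexF ≤ i + 1 := Nat.find_min' hexF hFi
  have hjmin := fun s => Nat.find_min hexF (m := s)
  set m := Nat.find hexF
  obtain ⟨j, hj⟩ : ∃ j, m = j + 1 := by
    refine Nat.exists_eq_succ_of_ne_zero fun h => hjF ?_
    rwa [h, hDs0]
  have hFj : hits (Ds j) F := not_not.1 (hjmin j (by omega))
  rw [hj, hstep] at hjF
  have hFU : F ⊆ U j :=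
    (hS F hF).subset_of_fire (hDs j) hFj fun v hv h => hjF ⟨v, hv, h⟩
  have hUU : U j ⊆ U i := by
    intro v
    simp only [U, Finset.mem_filter, Finset.mem_univ, true_and]
    intro h
    omega
  have h1 := hcut (U i) ⟨F, hF, E, hE, hFU.trans hUU, hEU⟩
  have h2 := edgesBetween_le_degree (G := G) (U := U i) (hDs i)
    (by rw [← hstep]; exact hDs _)
  have h3 : degree (Ds i) = degree D := by
    simp only [Ds, degree_sub, degree_laplacian, hdeg, sub_zero]
  omega

lemma IsScramble.le_gonality [Nonempty V] {S : Finset (Finset V)} (hS : G.IsScramble S) {r : ℕ}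
    (hhit : ∀ C : Finset V, IsHittingSet S C → r ≤ C.card)
    (hcut : ∀ A : Finset V, IsEggCut S A → r ≤ G.edgesBetween A Aᶜ) : r ≤ G.gonality := by
  obtain ⟨D, hD, hdeg⟩ := G.exists_rank_pos_degree_eq_gonality
  have := hS.le_degree hhit hcut hD
  omega

lemma IsScramble.isHittingSet_univ {S : Finset (Finset V)} (hS : G.IsScramble S) :
    IsHittingSet S Finset.univ := fun E hE => by
  obtain ⟨⟨v, hv⟩⟩ := (hS E hE).nonempty
  exact ⟨v, hv, Finset.mem_univ v⟩

lemma IsScramble.bddAbove_order {S : Finset (Finset V)} (hS : G.IsScramble S) :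
    BddAbove {k | (∀ C : Finset V, C.card < k → ¬ IsHittingSet S C) ∧
      ∀ A : Finset V, IsEggCut S A → k ≤ G.edgesBetween A Aᶜ} :=
  ⟨Fintype.card V, fun _ hk => not_lt.1 fun h => hk.1 Finset.univ h hS.isHittingSet_univ⟩

lemma IsScramble.scrambleOrder_spec {S : Finset (Finset V)} (hS : G.IsScramble S) :
    (∀ C : Finset V, C.card < G.scrambleOrder S → ¬ IsHittingSet S C) ∧
      ∀ A : Finset V, IsEggCut S A → G.scrambleOrder S ≤ G.edgesBetween A Aᶜ :=
  Nat.sSup_mem (s := {k | (∀ C : Finset V, C.card < k → ¬ IsHittingSet S C) ∧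
    ∀ A : Finset V, IsEggCut S A → k ≤ G.edgesBetween A Aᶜ}) ⟨0, by simp⟩ hS.bddAbove_order

lemma IsScramble.scrambleOrder_le_gonality [Nonempty V] {S : Finset (Finset V)}
    (hS : G.IsScramble S) : G.scrambleOrder S ≤ G.gonality :=
  hS.le_gonality (fun C hC => not_lt.1 fun h => hS.scrambleOrder_spec.1 C h hC)
    hS.scrambleOrder_spec.2

theorem scrambleNumber_le_gonality [Nonempty V] (G : Multigraph V) :
    G.scrambleNumber ≤ G.gonality := by
  refine csSup_le ⟨_, ∅, by simp [IsScramble], rfl⟩ ?_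
  rintro _ ⟨S, hS, rfl⟩
  exact hS.scrambleOrder_le_gonality

lemma IsScramble.le_scrambleNumber [Nonempty V] {S : Finset (Finset V)} (hS : G.IsScramble S)
    {r : ℕ} (hhit : ∀ C : Finset V, IsHittingSet S C → r ≤ C.card)
    (hcut : ∀ A : Finset V, IsEggCut S A → r ≤ G.edgesBetween A Aᶜ) : r ≤ G.scrambleNumber := by
  have h1 : r ≤ G.scrambleOrder S :=
    le_csSup hS.bddAbove_order ⟨fun C hC h => absurd (hhit C h) (by omega), hcut⟩
  refine h1.trans (le_csSup ⟨G.gonality, ?_⟩ ⟨S, hS, rfl⟩)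
  rintro _ ⟨S, hS, rfl⟩
  exact hS.scrambleOrder_le_gonality

end Scrambles

lemma mem_compl_iff [Fintype V] {A : Finset V} {v : V} : v ∈ Aᶜ ↔ v ∉ A := Finset.mem_compl

lemma ConnectedSubset.of_surjOn {G : Multigraph V} {H : Multigraph W} {S : Set V} {E : Finset W}
    (hS : (G.toSimple.induce S).Connected) (φ : V → W)
    (hφ : ∀ u v, 0 < G.mult u v → 0 < H.mult (φ u) (φ v)) (hmem : ∀ v ∈ S, φ v ∈ E)
    (hsurj : ∀ w ∈ E, ∃ v ∈ S, φ v = w) : H.ConnectedSubset E := by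
  refine SimpleGraph.Connected.map (H := H.toSimple.induce (E : Set W))
    ⟨fun v : S => ⟨φ v, hmem v v.2⟩, fun {u v} h => hφ u v h⟩ ?_ hS
  rintro ⟨w, hw⟩
  obtain ⟨v, hv, rfl⟩ := hsurj w hw
  exact ⟨⟨v, hv⟩, rfl⟩

/-! ### Edge boundaries and connectivity -/

section Connectivity

lemma exists_mult_pos_of_preconnected {G : Multigraph V} (h : G.toSimple.Preconnected) {A : Finset V} {x y : V}
    (hx : x ∈ A) (hy : y ∉ A) : ∃ a ∈ A, ∃ b, b ∉ A ∧ 0 < G.mult a b := by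
  obtain ⟨p⟩ := h x y
  obtain ⟨d, -, hd1, hd2⟩ := p.exists_boundary_dart (A : Set V) hx hy
  exact ⟨d.fst, hd1, d.snd, hd2, d.adj⟩

variable [Fintype V] (G : Multigraph V)

lemma edgesBetween_eq_sum_ite {A B : Finset V} (hB : ∀ v, v ∈ B ↔ v ∉ A) :
    G.edgesBetween A B = ∑ a, ∑ b, if a ∈ A ∧ b ∉ A then G.mult a b else 0 := by
  have h : ∀ a, (∑ b, if a ∈ A ∧ b ∉ A then G.mult a b else 0) =
      if a ∈ A then ∑ b ∈ B, G.mult a b else 0 := fun a => by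
    simp only [← hB, ite_and]
    split_ifs
    · rw [Finset.sum_ite_mem, Finset.univ_inter]
    · simp
  simp only [h, Finset.sum_ite_mem, Finset.univ_inter, edgesBetween]

lemma edgesBetween_compl_eq_sum_ite (A : Finset V) :
    G.edgesBetween A Aᶜ = ∑ a, ∑ b, if a ∈ A ∧ b ∉ A then G.mult a b else 0 :=
  G.edgesBetween_eq_sum_ite fun _ => Finset.mem_compl

/-- Links the count over unordered pairs to the one over ordered pairs: a boundary edge has exactly
one orientation from `A` to `Aᶜ`. -/
lemma sum_boundary_eq_edgesBetween (A : Finset V) :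
    ∑ e ∈ (A ×ˢ Aᶜ).image (fun p : V × V => s(p.1, p.2)), Sym2.lift ⟨G.mult, G.symm⟩ e =
      G.edgesBetween A Aᶜ := by
  rw [Finset.sum_image, Finset.sum_product]
  · rfl
  · rintro ⟨a, b⟩ h ⟨c, d⟩ h' hs
    simp only [Finset.coe_product, Set.mem_prod, Finset.mem_coe, Finset.mem_compl] at h h'
    simp only [Sym2.eq_iff] at hs
    rcases hs with ⟨h1, h2⟩ | ⟨h1, h2⟩
    · rw [h1, h2]
    · exact absurd h.1 (h1 ▸ h'.2)

lemma edgesBetween_le_numEdges (A : Finset V) : G.edgesBetween A Aᶜ ≤ G.numEdges := by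
  rw [← sum_boundary_eq_edgesBetween, numEdges]
  exact Finset.sum_le_sum_of_subset (Finset.subset_univ _)

/-- The edges of `G` joining `A` to its complement. -/
noncomputable def boundary (A : Finset V) : Multigraph V where
  mult u v := if (u ∈ A ↔ v ∈ A) then 0 else G.mult u v
  symm u v := by simp only [G.symm u v, iff_comm]
  loopless v := by simp

lemma numEdges_boundary (A : Finset V) : (G.boundary A).numEdges = G.edgesBetween A Aᶜ := by
  have h : (G.boundary A).edgesBetween A Aᶜ = G.edgesBetween A Aᶜ := by
    refine Finset.sum_congr rfl fun a ha => Finset.sum_congr rfl fun b hb => ?_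
    rw [Finset.mem_compl] at hb
    simp [boundary, ha, hb]
  rw [← h, ← sum_boundary_eq_edgesBetween, numEdges]
  refine (Finset.sum_subset (Finset.subset_univ _) fun e _ he => ?_).symm
  induction e with
  | h a b =>
    have hab : (a ∈ A ↔ b ∈ A) := by
      by_contra hab
      refine he (Finset.mem_image.2 ?_)
      by_cases ha : a ∈ A
      · exact ⟨(a, b), by simp_all, rfl⟩
      · exact ⟨(b, a), by simp_all, Sym2.eq_swap⟩
    simp [boundary, hab]

lemma edgeConnectivity_le {A : Finset V} (hA : A.Nonempty) (hAc : Aᶜ.Nonempty) :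
    G.edgeConnectivity ≤ G.edgesBetween A Aᶜ := by
  refine Nat.sInf_le ⟨G.boundary A, ⟨fun u v => ?_, Or.inl fun h => ?_⟩, G.numEdges_boundary A⟩
  · simp only [boundary]
    split_ifs <;> simp
  · obtain ⟨x, hx⟩ := hA
    obtain ⟨y, hy⟩ := hAc
    obtain ⟨a, ha, b, hb, hab⟩ := exists_mult_pos_of_preconnected h hx (Finset.mem_compl.1 hy)
    simp [deleteEdges, boundary, ha, hb] at hab

/-- After an edge cut, the set reachable from a suitable vertex has its whole boundary among the
deleted edges. `hV` excludes the one-vertex clause, and `hne` supplies an edge cut, since the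
infimum of an empty set would be `0`. -/
lemma le_edgeConnectivity (hV : Fintype.card V ≠ 1) {k : ℕ}
    (hne : ∃ A : Finset V, A.Nonempty ∧ Aᶜ.Nonempty)
    (h : ∀ A : Finset V, A.Nonempty → Aᶜ.Nonempty → k ≤ G.edgesBetween A Aᶜ) :
    k ≤ G.edgeConnectivity := by
  refine le_csInf ?_ ?_
  · obtain ⟨A, ⟨x, hx⟩, y, hy⟩ := hne
    refine ⟨_, G, ⟨fun _ _ => le_rfl, Or.inl fun hp => ?_⟩, rfl⟩
    obtain ⟨a, _, b, _, hab⟩ := exists_mult_pos_of_preconnected hp hx (Finset.mem_compl.1 hy)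
    simp [deleteEdges] at hab
  · rintro _ ⟨D, ⟨hD, hcut⟩, rfl⟩
    have hdis := hcut.resolve_right hV
    rw [SimpleGraph.Preconnected] at hdis
    push Not at hdis
    obtain ⟨x, y, hxy⟩ := hdis
    set A : Finset V := Finset.univ.filter fun z => (G.deleteEdges D).toSimple.Reachable x z
    refine (h A ⟨x, by simp [A]⟩ ⟨y, by simpa [A] using hxy⟩).trans
      (le_trans ?_ (D.edgesBetween_le_numEdges A))
    refine Finset.sum_le_sum fun a ha => Finset.sum_le_sum fun b hb => ?_
    simp only [A, Finset.mem_compl, Finset.mem_filter, Finset.mem_univ, true_and] at ha hb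
    by_contra hlt
    refine hb (ha.trans (SimpleGraph.Adj.reachable ?_))
    change 0 < G.mult a b - D.mult a b
    omega

lemma edgesBetween_singleton_compl (v : V) : G.edgesBetween {v} {v}ᶜ = G.valence v := by
  rw [edgesBetween, Finset.sum_singleton, valence,
    ← Finset.sum_add_sum_compl {v} fun u => G.mult v u]
  simp [G.loopless]

lemma edgeConnectivity_le_valence [Nontrivial V] (v : V) : G.edgeConnectivity ≤ G.valence v := by
  rw [← edgesBetween_singleton_compl]
  obtain ⟨w, hw⟩ := exists_ne v
  exact G.edgeConnectivity_le (Finset.singleton_nonempty v) ⟨w, by simpa using hw⟩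

/-- Deleting the neighbours of `v` isolates it or leaves it alone; parallel edges only increase the
valence. -/
lemma vertexConnectivity_le_valence (v : V) : G.vertexConnectivity ≤ G.valence v := by
  set S : Finset V := Finset.univ.filter fun u => 0 < G.mult v u with hSdef
  have hvS : v ∉ S := by simp [S, G.loopless]
  have hcard : S.card ≤ G.valence v := by
    rw [Finset.card_filter, valence]
    exact Finset.sum_le_sum fun u _ => by split_ifs <;> omega
  refine le_trans (Nat.sInf_le ⟨S, ⟨fun h => hvS (h ▸ Finset.mem_univ v), ?_⟩, rfl⟩) hcard
  by_cases h : ∃ w, w ≠ v ∧ w ∉ S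
  · left
    obtain ⟨w, hwv, hwS⟩ := h
    intro hpre
    obtain ⟨p⟩ := hpre ⟨v, by simpa using hvS⟩ ⟨w, by simpa using hwS⟩
    obtain ⟨d, -, hd1, hd2⟩ := p.exists_boundary_dart {z | (z : V) = v} rfl hwv
    have hadj : 0 < G.mult d.fst d.snd := d.adj
    have hd1' : (d.fst : V) = v := hd1
    rw [hd1'] at hadj
    have := d.snd.2
    simp [S, hadj] at this
  · right
    push Not at h
    have : insert v S = Finset.univ := by
      ext w
      by_cases hw : w = v
      · simp [hw]
      · simp [h w hw]
    rw [← Finset.card_univ, ← this, Finset.card_insert_of_notMem hvS]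

lemma le_vertexConnectivity [Nonempty V] {k : ℕ} (hV : k < Fintype.card V)
    (h : ∀ S : Finset V, S.card < k → (G.toSimple.induce ((S : Set V)ᶜ)).Preconnected) :
    k ≤ G.vertexConnectivity := by
  refine le_csInf ?_ ?_
  · obtain ⟨v⟩ := ‹Nonempty V›
    refine ⟨_, {v}ᶜ, ⟨fun h => ?_, Or.inr ?_⟩, rfl⟩
    · have := Finset.mem_univ v
      rw [← h] at this
      simp at this
    · have := Finset.card_compl_add_card ({v} : Finset V)
      simpa using this
  · rintro _ ⟨S, ⟨-, hS⟩, rfl⟩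
    by_contra hlt
    push Not at hlt
    rcases hS with hS | hS
    · exact hS (h S hlt)
    · omega

variable {G} in
lemma preconnected_of_card_lt_vertexConnectivity {S : Finset V}
    (h : S.card < G.vertexConnectivity) (hS : S ≠ Finset.univ) :
    (G.toSimple.induce ((S : Set V)ᶜ)).Preconnected := by
  by_contra hn
  exact absurd (Nat.sInf_le (s := {n | ∃ S : Finset V, G.IsVertexCut S ∧ S.card = n})
    ⟨S, ⟨hS, Or.inl hn⟩, rfl⟩) (not_le.2 h)

end Connectivity

/-! ### Cartesian products -/

section Product

/-- The intersection of `A` with the copy of the first factor over `w`. -/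
noncomputable def row [Fintype V] (A : Finset (V × W)) (w : W) : Finset V :=
  Finset.univ.filter fun v => (v, w) ∈ A

/-- The intersection of `A` with the copy of the second factor over `v`. -/
noncomputable def col [Fintype W] (A : Finset (V × W)) (v : V) : Finset W :=
  Finset.univ.filter fun w => (v, w) ∈ A

@[simp] lemma mem_row [Fintype V] {A : Finset (V × W)} {v : V} {w : W} :
    v ∈ row A w ↔ (v, w) ∈ A := by
  simp [row]

@[simp] lemma mem_col [Fintype W] {A : Finset (V × W)} {v : V} {w : W} :
    w ∈ col A v ↔ (v, w) ∈ A := by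
  simp [col]

lemma boxProd_swap (G : Multigraph V) (H : Multigraph W) (a b : V × W) :
    (H.boxProd G).mult (Equiv.prodComm V W a) (Equiv.prodComm V W b) =
      (G.boxProd H).mult a b := by
  simp only [boxProd, Equiv.prodComm_apply, Prod.fst_swap, Prod.snd_swap]
  exact add_comm _ _

variable [Fintype V] [Fintype W] (G : Multigraph V) (H : Multigraph W)

lemma card_eq_sum_card_row (A : Finset (V × W)) : A.card = ∑ w, (row A w).card := by
  simp only [row, Finset.card_filter]
  rw [← Fintype.sum_prod_type_right (f := fun p : V × W => if p ∈ A then 1 else 0)]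
  simp

/-- Every product edge lies in exactly one row or column. `B` is given by membership, so the
decidability instance behind a complement in `V × W` does not matter. -/
lemma edgesBetween_boxProd {A B : Finset (V × W)} (hB : ∀ a, a ∈ B ↔ a ∉ A) :
    (G.boxProd H).edgesBetween A B =
      ∑ w, G.edgesBetween (row A w) (row A w)ᶜ + ∑ v, H.edgesBetween (col A v) (col A v)ᶜ := by
  rw [edgesBetween_eq_sum_ite _ hB]
  simp only [edgesBetween_compl_eq_sum_ite, mem_row, mem_col]
  trans ∑ a : V × W, ∑ b : V × W,
    ((if a.2 = b.2 then (if a ∈ A ∧ b ∉ A then G.mult a.1 b.1 else 0) else 0) +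
      (if a.1 = b.1 then (if a ∈ A ∧ b ∉ A then H.mult a.2 b.2 else 0) else 0))
  · refine Finset.sum_congr rfl fun a _ => Finset.sum_congr rfl fun b _ => ?_
    simp only [boxProd]
    split_ifs <;> omega
  simp only [Finset.sum_add_distrib]
  congr 1
  · rw [Fintype.sum_prod_type_right]
    refine Finset.sum_congr rfl fun w _ => Finset.sum_congr rfl fun v _ => ?_
    rw [Fintype.sum_prod_type]
    simp
  · rw [Fintype.sum_prod_type]
    refine Finset.sum_congr rfl fun v _ => Finset.sum_congr rfl fun w _ => ?_
    rw [Fintype.sum_prod_type_right]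
    simp

lemma valence_boxProd (a : V × W) : (G.boxProd H).valence a = G.valence a.1 + H.valence a.2 := by
  simp only [valence, boxProd, Finset.sum_add_distrib]
  rw [Fintype.sum_prod_type, Fintype.sum_prod_type_right, add_comm]
  simp

/-- The vertex set `A` meets, but does not contain, the vertex set of the graph. -/
def Splits (A : Finset V) : Prop := A.Nonempty ∧ Aᶜ.Nonempty

lemma mul_card_splits_le_sum {ι : Type*} [Fintype ι] {k : ℕ} (hk : k ≤ G.edgeConnectivity)
    (A : ι → Finset V) :
    k * (Finset.univ.filter fun i => Splits (A i)).card ≤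
      ∑ i, G.edgesBetween (A i) (A i)ᶜ := by
  rw [Finset.card_filter, Finset.mul_sum]
  refine Finset.sum_le_sum fun i _ => ?_
  split_ifs with h
  · simpa using hk.trans (G.edgeConnectivity_le h.1 h.2)
  · simp

lemma laplacian_boxProd_fst (f : V → ℤ) (a : V × W) :
    (G.boxProd H).laplacian (fun b => f b.1) a = G.laplacian f a.1 := by
  simp only [laplacian, boxProd]
  rw [Fintype.sum_prod_type]
  refine Finset.sum_congr rfl fun v _ => ?_
  dsimp only
  rw [← Finset.mul_sum]
  push_cast
  rw [Finset.sum_add_distrib]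
  by_cases h : a.1 = v
  · simp [h]
  · simp [h]

variable {G} in
/-- Copying a divisor of positive rank into every fibre gives a divisor of positive rank. -/
lemma rank_pos_boxProd_fst [Nonempty V] [Nonempty W] {D : V → ℤ} (h : 0 < G.rank D) :
    0 < (G.boxProd H).rank fun a => D a.1 := by
  rw [rank_pos_iff] at h ⊢
  rintro ⟨v, w⟩
  obtain ⟨f, hf, hfv⟩ := h v
  have he : ((fun a => D a.1) - (G.boxProd H).laplacian fun b => f b.1) =
      fun a => (D - G.laplacian f) a.1 := by
    funext a
    simp [laplacian_boxProd_fst]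
  exact ⟨fun b => f b.1, by rw [he]; exact fun a => hf a.1, by rw [he]; exact hfv⟩

lemma gonality_boxProd_le [Nonempty V] [Nonempty W] :
    (G.boxProd H).gonality ≤ G.gonality * Fintype.card W := by
  obtain ⟨D, hD, hdeg⟩ := G.exists_rank_pos_degree_eq_gonality
  have h := (G.boxProd H).gonality_le (rank_pos_boxProd_fst H hD)
  have h2 : degree (fun a : V × W => D a.1) = G.gonality * Fintype.card W := by
    rw [← hdeg, degree, Fintype.sum_prod_type, degree, Finset.sum_mul]
    simp [mul_comm]
  rw [h2] at h
  exact_mod_cast h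

end Product

/-! ### Relabelling the vertices -/

section Relabel

variable [Fintype V] [Fintype W] {G : Multigraph V} {H : Multigraph W}

lemma laplacian_relabel (e : V ≃ W) (he : ∀ u v, H.mult (e u) (e v) = G.mult u v)
    (f : W → ℤ) (v : V) : H.laplacian f (e v) = G.laplacian (f ∘ e) v := by
  rw [laplacian, ← e.sum_comp]
  simp [laplacian, he]

/-- Isomorphism invariance, needed only to exchange the factors of a product. -/
lemma gonality_le_of_relabel [Nonempty V] (e : V ≃ W)
    (he : ∀ u v, H.mult (e u) (e v) = G.mult u v) : G.gonality ≤ H.gonality := by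
  have : Nonempty W := e.nonempty_congr.1 inferInstance
  obtain ⟨D, hD, hdeg⟩ := H.exists_rank_pos_degree_eq_gonality
  have h : 0 < G.rank (D ∘ e) := by
    rw [rank_pos_iff] at hD ⊢
    intro v
    obtain ⟨f, hf, hfv⟩ := hD (e v)
    have heq : D ∘ e - G.laplacian (f ∘ e) = (D - H.laplacian f) ∘ e := by
      funext u
      simp [laplacian_relabel e he]
    exact ⟨f ∘ e, by rw [heq]; exact fun u => hf (e u), by rw [heq]; exact hfv⟩
  have h2 := G.gonality_le h
  have h3 : degree (D ∘ e) = degree D := e.sum_comp D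
  omega

lemma edgesBetween_relabel (e : V ≃ W) (he : ∀ u v, H.mult (e u) (e v) = G.mult u v)
    (A : Finset W) :
    H.edgesBetween A Aᶜ =
      G.edgesBetween (A.map e.symm.toEmbedding) (A.map e.symm.toEmbedding)ᶜ := by
  have hmem : ∀ v, v ∈ A.map e.symm.toEmbedding ↔ e v ∈ A := fun v => by simp
  simp only [edgesBetween_compl_eq_sum_ite, hmem]
  rw [← e.sum_comp]
  refine Finset.sum_congr rfl fun v _ => ?_
  rw [← e.sum_comp]
  simp [he]

lemma scrambleNumber_le_of_relabel [Nonempty V] (e : V ≃ W)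
    (he : ∀ u v, H.mult (e u) (e v) = G.mult u v) : G.scrambleNumber ≤ H.scrambleNumber := by
  have : Nonempty W := e.nonempty_congr.1 inferInstance
  refine csSup_le ⟨_, ∅, by simp [IsScramble], rfl⟩ ?_
  rintro _ ⟨S, hS, rfl⟩
  set S' : Finset (Finset W) := S.image fun E => E.map e.toEmbedding
  have hS' : H.IsScramble S' := by
    intro E' hE'
    obtain ⟨E, hE, rfl⟩ := Finset.mem_image.1 hE'
    exact .of_surjOn (hS E hE) e (fun u v h => by rwa [he])
      (fun v hv => Finset.mem_map_of_mem _ hv) fun w hw => Finset.mem_map.1 hw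
  obtain ⟨h1, h2⟩ := hS.scrambleOrder_spec
  refine hS'.le_scrambleNumber (fun C hC => ?_) fun A hA => ?_
  · by_contra hlt
    refine h1 (C.map e.symm.toEmbedding) (by simpa using hlt) fun E hE => ?_
    obtain ⟨w, hw, hwC⟩ := hC _ (Finset.mem_image_of_mem _ hE)
    obtain ⟨v, hv, rfl⟩ := Finset.mem_map.1 hw
    exact ⟨v, hv, by simpa using hwC⟩
  · rw [edgesBetween_relabel e he]
    refine h2 _ ?_
    obtain ⟨E₁, hE₁, E₂, hE₂, h1A, h2A⟩ := hA
    obtain ⟨F₁, hF₁, rfl⟩ := Finset.mem_image.1 hE₁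
    obtain ⟨F₂, hF₂, rfl⟩ := Finset.mem_image.1 hE₂
    refine ⟨F₁, hF₁, F₂, hF₂, fun v hv => ?_, fun v hv => ?_⟩
    · have := h1A (Finset.mem_map_of_mem e.toEmbedding hv)
      simpa using this
    · have := h2A (Finset.mem_map_of_mem e.toEmbedding hv)
      simpa using this

lemma gonality_boxProd_comm [Nonempty V] [Nonempty W] (G : Multigraph V) (H : Multigraph W) :
    (G.boxProd H).gonality = (H.boxProd G).gonality :=
  le_antisymm (gonality_le_of_relabel _ (boxProd_swap G H))
    (gonality_le_of_relabel _ (boxProd_swap H G))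

lemma scrambleNumber_boxProd_comm [Nonempty V] [Nonempty W] (G : Multigraph V)
    (H : Multigraph W) : (G.boxProd H).scrambleNumber = (H.boxProd G).scrambleNumber :=
  le_antisymm (scrambleNumber_le_of_relabel _ (boxProd_swap G H))
    (scrambleNumber_le_of_relabel _ (boxProd_swap H G))

end Relabel

/-! ### A scramble on a Cartesian product -/

section ProductScramble

variable [Fintype V] [Fintype W]

lemma not_splits_iff {A : Finset V} : ¬ Splits A ↔ (∀ v, v ∉ A) ∨ ∀ v, v ∈ A := by
  simp only [Splits, Finset.Nonempty, Finset.mem_compl]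
  grind

/-- The eggs are the copies of the sets `Sᶜ`, for `S` of size `k - 1`, in all the fibres. -/
noncomputable def fibreScramble (V W : Type*) [Fintype V] [Fintype W] (k : ℕ) :
    Finset (Finset (V × W)) :=
  Finset.univ.filter fun E => ∃ (w : W) (S : Finset V), S.card + 1 = k ∧ E = Sᶜ ×ˢ {w}

variable {G : Multigraph V} {H : Multigraph W} {k : ℕ}

lemma isScramble_fibreScramble (hκ : k ≤ G.vertexConnectivity)
    (hn : 2 * k ≤ Fintype.card V + 1) : (G.boxProd H).IsScramble (fibreScramble V W k) := by
  intro E hE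
  simp only [fibreScramble, Finset.mem_filter, Finset.mem_univ, true_and] at hE
  obtain ⟨w, S, hS, rfl⟩ := hE
  have hSn : S.card < Fintype.card V := by omega
  have hSu : S ≠ Finset.univ := fun h => by simp [h] at hSn
  have hpre := preconnected_of_card_lt_vertexConnectivity (G := G) (S := S) (by omega) hSu
  obtain ⟨v, hv⟩ : ∃ v, v ∉ S := by
    by_contra hcon
    push Not at hcon
    exact hSu (Finset.eq_univ_of_forall hcon)
  have hcon : (G.toSimple.induce ((S : Set V)ᶜ)).Connected :=
    { preconnected := hpre, nonempty := ⟨⟨v, by simpa using hv⟩⟩ }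
  refine .of_surjOn hcon (fun v => (v, w)) (fun u v h => ?_) (fun v hv => ?_) ?_
  · simp [boxProd, h]
  · rw [Finset.mem_product, Finset.mem_compl, Finset.mem_singleton]
    exact ⟨hv, rfl⟩
  · rintro ⟨v, u⟩ hvu
    rw [Finset.mem_product, Finset.mem_compl, Finset.mem_singleton] at hvu
    exact ⟨v, hvu.1, Prod.ext rfl hvu.2.symm⟩

lemma le_card_of_isHittingSet_fibreScramble (hk : 1 ≤ k) (hn : 2 * k ≤ Fintype.card V + 1)
    {C : Finset (V × W)} (hC : IsHittingSet (fibreScramble V W k) C) :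
    k * Fintype.card W ≤ C.card := by
  rw [card_eq_sum_card_row, mul_comm, ← smul_eq_mul]
  refine Finset.card_nsmul_le_sum _ _ _ fun w _ => ?_
  by_contra hlt
  push Not at hlt
  -- A row with fewer than `k` points of `C` extends to a set of size exactly `k - 1`, whose
  -- complement is an egg missed by `C`.
  obtain ⟨S, hRS, -, hS⟩ := Finset.exists_subsuperset_card_eq (n := k - 1)
    (Finset.subset_univ (row C w)) (by omega) (by rw [Finset.card_univ]; omega)
  obtain ⟨⟨v, u⟩, hv, hvC⟩ := hC (Sᶜ ×ˢ {w}) (by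
    simp only [fibreScramble, Finset.mem_filter, Finset.mem_univ, true_and]
    exact ⟨w, S, by omega, rfl⟩)
  rw [Finset.mem_product, Finset.mem_compl, Finset.mem_singleton] at hv
  obtain ⟨hv, rfl : u = w⟩ := hv
  exact hv (hRS (mem_row.2 hvC))

/-- If all rows split, they number `|W|`. Otherwise some row is full or empty, and comparing it with
the egg on the other side splits all but at most `k - 1` columns. With one split row this gives `|V|
- k + 2`; with none, row `w` is full, row `w'` is empty and all `|V|` columns split. Both are at
least `|V| - 2k + 4` once `k ≥ 2`. -/
lemma le_edgesBetween_of_fibres {A B : Finset (V × W)} (hB : ∀ a, a ∈ B ↔ a ∉ A) (hk : 1 ≤ k)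
    (hG : k ≤ G.edgeConnectivity) (hH : k ≤ H.edgeConnectivity)
    (hn : 2 * k ≤ Fintype.card V + 1) (hm : Fintype.card W + 2 * k ≤ Fintype.card V + 4)
    (h1 : k = 1 → Fintype.card W ≤ Fintype.card V * H.edgeConnectivity)
    {w w' : W} {S S' : Finset V} (hS : S.card + 1 = k) (hS' : S'.card + 1 = k)
    (hA : ∀ v, v ∉ S → (v, w) ∈ A) (hA' : ∀ v, v ∉ S' → (v, w') ∉ A) :
    k * Fintype.card W ≤ (G.boxProd H).edgesBetween A B := by
  rw [edgesBetween_boxProd _ _ hB]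
  have hrows := G.mul_card_splits_le_sum hG fun w => row A w
  have hcols := H.mul_card_splits_le_sum hH fun v => col A v
  have hcols1 := H.mul_card_splits_le_sum le_rfl fun v => col A v
  set R := (Finset.univ.filter fun w => Splits (row A w)).card with hR
  set C := (Finset.univ.filter fun v => Splits (col A v)).card with hC
  have hexv (T : Finset V) (hT : T.card + 1 = k) : ∃ v, v ∉ T := by
    by_contra hcon
    push Not at hcon
    have : T.card = Fintype.card V := by
      rw [Finset.eq_univ_of_forall hcon, Finset.card_univ]
    omega
  have hcount (T : Finset V) (hT : ∀ v, v ∉ T → Splits (col A v)) :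
      Fintype.card V ≤ C + T.card := by
    have h2 : Tᶜ ⊆ Finset.univ.filter fun v => Splits (col A v) := fun v hv => by
      simpa using hT v (Finset.mem_compl.1 hv)
    have h3 := Finset.card_le_card h2
    rw [Finset.card_compl] at h3
    omega
  have hfull (u : W) (hu : ∀ v, (v, u) ∈ A) : Fintype.card V + 1 ≤ C + k := by
    have := hcount S' fun v hv => ⟨⟨u, by simpa using hu v⟩, ⟨w', by simpa using hA' v hv⟩⟩
    omega
  have hempty (u : W) (hu : ∀ v, (v, u) ∉ A) : Fintype.card V + 1 ≤ C + k := by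
    have := hcount S fun v hv => ⟨⟨w, by simpa using hA v hv⟩, ⟨u, by simpa using hu v⟩⟩
    omega
  have hall (hw : ¬ Splits (row A w)) (hw' : ¬ Splits (row A w')) : Fintype.card V ≤ C := by
    obtain ⟨v, hv⟩ := hexv S hS
    obtain ⟨v', hv'⟩ := hexv S' hS'
    rw [not_splits_iff] at hw hw'
    simp only [mem_row] at hw hw'
    have hw2 := hw.resolve_left fun h => h v (hA v hv)
    have hw2' := hw'.resolve_right fun h => hA' v' hv' (h v')
    simpa using hcount ∅ fun v _ => ⟨⟨w, by simpa using hw2 v⟩, ⟨w', by simpa using hw2' v⟩⟩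
  rcases hk.eq_or_lt with rfl | hk2
  -- For `k = 1` the eggs are whole fibres, so every column splits and contributes `λ(H)` edges.
  · have hS0 : S = ∅ := Finset.card_eq_zero.1 (by omega)
    have hS0' : S' = ∅ := Finset.card_eq_zero.1 (by omega)
    subst hS0 hS0'
    have hCn := hfull w fun v => hA v (by simp)
    have h2 : Fintype.card V * H.edgeConnectivity ≤ H.edgeConnectivity * C := by
      rw [mul_comm]
      exact Nat.mul_le_mul_left _ (by omega)
    have := h1 rfl
    omega
  · have key : Fintype.card W ≤ R + C := by
      by_cases hsp : ∀ u, Splits (row A u)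
      · have : R = Fintype.card W := by
          rw [hR, Finset.filter_true_of_mem fun u _ => hsp u, Finset.card_univ]
        omega
      · push Not at hsp
        obtain ⟨u, hu⟩ := hsp
        have hCk : Fintype.card V + 1 ≤ C + k := by
          rw [not_splits_iff] at hu
          simp only [mem_row] at hu
          exact hu.elim (hempty u) (hfull u)
        by_cases hR0 : R = 0
        · rw [hR, Finset.card_eq_zero, Finset.filter_eq_empty_iff] at hR0
          have := hall (hR0 (Finset.mem_univ w)) (hR0 (Finset.mem_univ w'))
          omega
        · omega
    calc k * Fintype.card W ≤ k * (R + C) := Nat.mul_le_mul_left _ key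
      _ = k * R + k * C := mul_add _ _ _
      _ ≤ _ := add_le_add hrows hcols

theorem le_scrambleNumber_boxProd [Nonempty V] [Nonempty W] (hk : 1 ≤ k)
    (hκ : k ≤ G.vertexConnectivity) (hG : k ≤ G.edgeConnectivity) (hH : k ≤ H.edgeConnectivity)
    (hn : 2 * k ≤ Fintype.card V + 1) (hm : Fintype.card W + 2 * k ≤ Fintype.card V + 4)
    (h1 : k = 1 → Fintype.card W ≤ Fintype.card V * H.edgeConnectivity) :
    k * Fintype.card W ≤ (G.boxProd H).scrambleNumber := by
  refine (isScramble_fibreScramble hκ hn).le_scrambleNumber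
    (fun C hC => le_card_of_isHittingSet_fibreScramble hk hn hC) fun A hA => ?_
  obtain ⟨E₁, hE₁, E₂, hE₂, h1A, h2A⟩ := hA
  simp only [fibreScramble, Finset.mem_filter, Finset.mem_univ, true_and] at hE₁ hE₂
  obtain ⟨w, S, hS, rfl⟩ := hE₁
  obtain ⟨w', S', hS', rfl⟩ := hE₂
  refine le_edgesBetween_of_fibres (fun _ => mem_compl_iff) hk hG hH hn hm h1 hS hS'
    (w := w) (w' := w') (fun v hv => h1A ?_) fun v hv => mem_compl_iff.1 (h2A ?_)
  · simpa using hv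
  · simpa using hv

theorem scrambleNumber_and_gonality_boxProd [Nonempty V] [Nonempty W]
    (hκ : G.vertexConnectivity = k) (hG : G.edgeConnectivity = k) (hgon : G.gonality = k)
    (hH : k ≤ H.edgeConnectivity) (hn : 2 * k ≤ Fintype.card V + 1)
    (hm : Fintype.card W + 2 * k ≤ Fintype.card V + 4)
    (h1 : k = 1 → Fintype.card W ≤ Fintype.card V * H.edgeConnectivity) :
    (G.boxProd H).scrambleNumber = k * Fintype.card W ∧
      (G.boxProd H).gonality = k * Fintype.card W := by
  have hlow : k * Fintype.card W ≤ (G.boxProd H).scrambleNumber := by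
    rcases Nat.eq_zero_or_pos k with rfl | hk
    · simp
    · exact le_scrambleNumber_boxProd hk hκ.ge hG.ge hH hn hm h1
  have hmid := scrambleNumber_le_gonality (G.boxProd H)
  have hup := G.gonality_boxProd_le H
  rw [hgon] at hup
  omega

end ProductScramble

/-! ### Complete graphs and trees -/

section CompleteTree

variable [Fintype V]

lemma valence_complete (v : V) : (complete V).valence v = Fintype.card V - 1 := by
  simp only [valence, complete]
  rw [Finset.sum_ite, Finset.sum_const_zero, zero_add, Finset.sum_const, smul_eq_mul, mul_one,
    Finset.filter_not, Finset.filter_eq, if_pos (Finset.mem_univ v), Finset.card_sdiff]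
  simp

lemma edgesBetween_complete (A : Finset V) :
    (complete V).edgesBetween A Aᶜ = A.card * Aᶜ.card := by
  have h : ∀ a ∈ A, ∀ b ∈ Aᶜ, (complete V).mult a b = 1 := fun a ha b hb => by
    rw [Finset.mem_compl] at hb
    have : a ≠ b := fun h => hb (h ▸ ha)
    simp [complete, this]
  rw [edgesBetween, Finset.sum_congr rfl fun a ha => Finset.sum_congr rfl (h a ha)]
  simp

lemma exists_nonempty_compl_nonempty [Nontrivial V] :
    ∃ A : Finset V, A.Nonempty ∧ Aᶜ.Nonempty := by
  obtain ⟨x, y, hxy⟩ := exists_pair_ne V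
  exact ⟨{x}, by simp, y, by simpa using hxy.symm⟩

/-- With sides of sizes `a + 1` and `b + 1` the cut has `(a + 1) * (b + 1) ≥ a + b + 1` edges. -/
lemma le_edgeConnectivity_complete [Nontrivial V] :
    Fintype.card V - 1 ≤ (complete V).edgeConnectivity := by
  refine le_edgeConnectivity _ Fintype.one_lt_card.ne' exists_nonempty_compl_nonempty
    fun A hA hAc => ?_
  rw [edgesBetween_complete]
  have h1 := hA.card_pos
  have h2 := hAc.card_pos
  have h3 := Finset.card_add_card_compl A
  obtain ⟨a, ha⟩ := Nat.exists_eq_add_of_lt h1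
  obtain ⟨b, hb⟩ := Nat.exists_eq_add_of_lt h2
  rw [ha, hb] at h3 ⊢
  rw [← h3]
  ring_nf
  omega

lemma Connected.one_le_edgeConnectivity [Nontrivial V] {G : Multigraph V} (h : G.Connected) :
    1 ≤ G.edgeConnectivity := by
  refine le_edgeConnectivity _ Fintype.one_lt_card.ne' exists_nonempty_compl_nonempty
    fun A hA hAc => ?_
  obtain ⟨x, hx⟩ := hA
  obtain ⟨y, hy⟩ := hAc
  obtain ⟨a, ha, b, hb, hab⟩ :=
    exists_mult_pos_of_preconnected h.preconnected hx (Finset.mem_compl.1 hy)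
  calc 1 ≤ G.mult a b := hab
    _ ≤ ∑ c ∈ Aᶜ, G.mult a c :=
      Finset.single_le_sum (f := fun c => G.mult a c) (fun _ _ => Nat.zero_le _)
        (Finset.mem_compl.2 hb)
    _ ≤ _ := Finset.single_le_sum (f := fun a => ∑ c ∈ Aᶜ, G.mult a c)
        (fun _ _ => Nat.zero_le _) ha

lemma IsTree.exists_valence_eq_one [Nontrivial V] {T : Multigraph V} (hT : T.IsTree) :
    ∃ v, T.valence v = 1 := by
  obtain ⟨v, hv⟩ := hT.1.exists_vert_degree_one_of_nontrivial
  refine ⟨v, ?_⟩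
  rw [← hv, ← SimpleGraph.card_neighborFinset_eq_degree, SimpleGraph.neighborFinset_eq_filter,
    Finset.card_filter, valence]
  refine Finset.sum_congr rfl fun u _ => ?_
  have := hT.2 v u
  by_cases h : 0 < T.mult v u <;> simp [toSimple, h] <;> omega

/-- In a tree, a chip can be moved along an edge by firing one side of the edge. -/
lemma IsTree.exists_laplacian_eq_of_adj {T : Multigraph V} (hT : T.IsTree) {u v : V}
    (huv : T.toSimple.Adj u v) :
    ∃ f : V → ℤ, T.laplacian f = Pi.single u 1 - Pi.single v 1 := by
  have hbr := SimpleGraph.isBridge_iff.1 (SimpleGraph.isAcyclic_iff_forall_adj_isBridge.1 hT.1.2 huv)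
  set K := T.toSimple.deleteEdges {s(u, v)} with hK
  -- The side of `u` once the bridge `uv` is removed; `uv` is then the only edge leaving it, and it
  -- is simple.
  set U : Finset V := Finset.univ.filter fun x => K.Reachable u x
  have hu : u ∈ U := by simp [U]
  have hv : v ∉ U := by simpa [U] using hbr
  have hmult : T.mult u v = 1 := by
    have h1 : 0 < T.mult u v := huv
    have h2 := hT.2 u v
    omega
  have hne : u ≠ v := huv.ne
  have hcross : ∀ a b, a ∈ U → b ∉ U → 0 < T.mult a b → a = u ∧ b = v := by
    intro a b ha hb hab
    by_contra hcon
    refine hb ?_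
    simp only [U, Finset.mem_filter, Finset.mem_univ, true_and] at ha ⊢
    refine ha.trans (SimpleGraph.Adj.reachable ?_)
    have hadj : T.toSimple.Adj a b := hab
    rw [hK, SimpleGraph.deleteEdges_adj]
    refine ⟨hadj, fun h => ?_⟩
    rw [Set.mem_singleton_iff, Sym2.eq_iff] at h
    rcases h with h | h
    · exact hcon h
    · refine hv ?_
      rw [← h.1]
      simpa [U] using ha
  refine ⟨indicator U, ?_⟩
  have hterm : ∀ a b, (indicator U a - indicator U b) * (T.mult a b : ℤ) =
      (if b = v then if a = u then 1 else 0 else 0) -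
        if b = u then if a = v then 1 else 0 else 0 := by
    intro a b
    by_cases ha : a ∈ U <;> by_cases hb : b ∈ U
    · have : b ≠ v := fun h => hv (h ▸ hb)
      have : a ≠ v := fun h => hv (h ▸ ha)
      simp [indicator, *]
    · by_cases hab : a = u ∧ b = v
      · obtain ⟨rfl, rfl⟩ := hab
        simp [indicator, ha, hb, hmult, hne]
      · have h0 : T.mult a b = 0 := by
          by_contra h
          exact hab (hcross a b ha hb (Nat.pos_of_ne_zero h))
        have : b ≠ u := fun h => hb (h ▸ hu)
        rw [h0]
        grind
    · by_cases hab : b = u ∧ a = v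
      · obtain ⟨rfl, rfl⟩ := hab
        simp [indicator, ha, hb, T.symm a b, hmult, hne]
      · have h0 : T.mult a b = 0 := by
          by_contra h
          exact hab (hcross b a hb ha (by rw [T.symm]; exact Nat.pos_of_ne_zero h))
        have : a ≠ u := fun h => ha (h ▸ hu)
        rw [h0]
        grind
    · have : b ≠ u := fun h => hb (h ▸ hu)
      have : a ≠ u := fun h => ha (h ▸ hu)
      simp [indicator, *]
  funext a
  simp only [laplacian, hterm, Finset.sum_sub_distrib, Finset.sum_ite_eq', Finset.mem_univ,
    if_true, Pi.sub_apply, Pi.single_apply]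

/-- A single chip can be carried along a path to any vertex. -/
lemma IsTree.gonality_le_one {T : Multigraph V} (hT : T.IsTree) : T.gonality ≤ 1 := by
  obtain ⟨v₀⟩ := hT.1.1.nonempty
  have : Nonempty V := ⟨v₀⟩
  have hmove : ∀ v, ∃ f : V → ℤ, T.laplacian f = Pi.single v₀ 1 - Pi.single v 1 := by
    intro v
    have h := (SimpleGraph.reachable_iff_reflTransGen v₀ v).1 (hT.1.1.preconnected v₀ v)
    induction h with
    | refl => exact ⟨0, by rw [laplacian_zero, sub_self]⟩
    | tail _ hadj ih =>
      obtain ⟨f, hf⟩ := ih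
      obtain ⟨g, hg⟩ := hT.exists_laplacian_eq_of_adj hadj
      exact ⟨f + g, by rw [laplacian_add, hf, hg]; abel⟩
  have hrank : 0 < T.rank (Pi.single v₀ 1) := by
    rw [rank_pos_iff]
    intro v
    obtain ⟨f, hf⟩ := hmove v
    refine ⟨f, ?_, ?_⟩ <;> rw [hf, sub_sub_cancel]
    · exact Pi.single_nonneg.2 zero_le_one
    · simp
  have := T.gonality_le hrank
  rw [degree_single] at this
  omega

/-! ### Connectivity and gonality of the product of a complete graph with a tree -/

variable [Fintype W] [Nonempty V]

/-- Fewer than `|V|` deletions leave some copy `{i} × W` of `T` intact, and each surviving vertex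
lies on it or is adjacent to it through its clique. -/
lemma le_vertexConnectivity_complete_boxProd [Nontrivial W] {T : Multigraph W}
    (hT : T.Connected) :
    Fintype.card V ≤ ((complete V).boxProd T).vertexConnectivity := by
  refine le_vertexConnectivity _ ?_ fun S hS => ?_
  · rw [Fintype.card_prod]
    exact lt_mul_of_one_lt_right Fintype.card_pos Fintype.one_lt_card
  obtain ⟨i, hi⟩ : ∃ i, ∀ t, (i, t) ∉ S := by
    by_contra hcon
    push Not at hcon
    have h1 : Finset.univ ⊆ S.image Prod.fst := fun i _ => by
      obtain ⟨t, ht⟩ := hcon i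
      exact Finset.mem_image_of_mem Prod.fst ht
    have h2 := (Finset.card_le_card h1).trans Finset.card_image_le
    rw [Finset.card_univ] at h2
    omega
  set K := ((complete V).boxProd T).toSimple.induce ((S : Set (V × W))ᶜ)
  let c (t : W) : ((S : Set (V × W))ᶜ : Set (V × W)) := ⟨(i, t), by simpa using hi t⟩
  let φ : T.toSimple →g K := ⟨c, fun {s t} (h : 0 < T.mult s t) => by
    change 0 < ((complete V).boxProd T).mult (i, s) (i, t)
    simp [boxProd, h]⟩
  have hfib : ∀ s t, K.Reachable (c s) (c t) := fun s t => (hT.preconnected s t).map φ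
  have hto : ∀ x : ((S : Set (V × W))ᶜ : Set (V × W)), K.Reachable x (c x.1.2) := by
    rintro ⟨⟨j, t⟩, hx⟩
    by_cases hj : j = i
    · subst hj
      exact SimpleGraph.Reachable.refl _
    · refine SimpleGraph.Adj.reachable ?_
      change 0 < ((complete V).boxProd T).mult (j, t) (i, t)
      simp [boxProd, complete, hj]
  exact fun x y => ((hto x).trans (hfib _ _)).trans (hto y).symm

/-- If every column splits, each gives an edge. Otherwise an unsplit column `i` disagrees with some
column `j` in a row, and that row gives `|V| - 1` edges. Either column `j` splits and adds one more,
or columns `i` and `j` are constant and opposite, so all rows split; there are at least two. -/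
lemma le_edgeConnectivity_complete_boxProd [Nontrivial W] {T : Multigraph W}
    (hT : T.Connected) :
    Fintype.card V ≤ ((complete V).boxProd T).edgeConnectivity := by
  have hW : 1 < Fintype.card W := Fintype.one_lt_card
  have hV : 0 < Fintype.card V := Fintype.card_pos
  refine le_edgeConnectivity _ ?_ exists_nonempty_compl_nonempty fun A hA hAc => ?_
  · rw [Fintype.card_prod]
    exact (one_lt_mul_of_le_of_lt (Nat.succ_le_of_lt hV) hW).ne'
  rw [edgesBetween_boxProd _ _ fun _ => mem_compl_iff]
  have hcols := T.mul_card_splits_le_sum hT.one_le_edgeConnectivity fun v : V => col A v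
  set C := (Finset.univ.filter fun v : V => Splits (col A v)).card with hC
  by_cases hall : ∀ v, Splits (col A v)
  · have : C = Fintype.card V := by
      rw [hC, Finset.filter_true_of_mem fun u _ => hall u, Finset.card_univ]
    omega
  push Not at hall
  obtain ⟨i, hi⟩ := hall
  obtain ⟨j, t, hjt⟩ : ∃ j t, ¬ ((i, t) ∈ A ↔ (j, t) ∈ A) := by
    rw [not_splits_iff] at hi
    simp only [mem_col] at hi
    rcases hi with hi | hi
    · obtain ⟨⟨j, t⟩, hjt⟩ := hA
      exact ⟨j, t, by simp [hi t, hjt]⟩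
    · obtain ⟨⟨j, t⟩, hjt⟩ := hAc
      rw [mem_compl_iff] at hjt
      exact ⟨j, t, by simp [hi t, hjt]⟩
  have hij : i ≠ j := fun h => hjt (by rw [h])
  have : Nontrivial V := ⟨i, j, hij⟩
  have hV2 : 1 < Fintype.card V := Fintype.one_lt_card
  have hrows := (complete V).mul_card_splits_le_sum le_edgeConnectivity_complete fun w => row A w
  set R := (Finset.univ.filter fun w : W => Splits (row A w)).card with hR
  have hsplit : ∀ s, ¬ ((i, s) ∈ A ↔ (j, s) ∈ A) → Splits (row A s) := by
    intro s hs
    by_contra hcon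
    rw [not_splits_iff] at hcon
    simp only [mem_row] at hcon
    rcases hcon with h | h <;> simp [h] at hs
  by_cases hj : Splits (col A j)
  · have h1 : 1 ≤ C := Finset.card_pos.2 ⟨j, by simpa using hj⟩
    have h2 : 1 ≤ R := Finset.card_pos.2 ⟨t, by simpa using hsplit t hjt⟩
    have h3 := Nat.mul_le_mul_left (Fintype.card V - 1) h2
    omega
  · have h2 : R = Fintype.card W := by
      rw [hR, Finset.filter_true_of_mem, Finset.card_univ]
      intro s _
      refine hsplit s ?_
      rw [not_splits_iff] at hi hj
      simp only [mem_col] at hi hj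
      rcases hi with hi | hi <;> rcases hj with hj | hj <;> simp_all
    have h3 : (Fintype.card V - 1) * 2 ≤ (Fintype.card V - 1) * R :=
      Nat.mul_le_mul_left _ (by omega)
    omega

/-- Take all singletons as eggs: only the full vertex set hits them, and an egg-cut is any proper
nonempty set. -/
lemma le_gonality_of_le_edgeConnectivity {G : Multigraph V} {k : ℕ} (hk : k ≤ Fintype.card V)
    (hG : k ≤ G.edgeConnectivity) : k ≤ G.gonality := by
  have hS : G.IsScramble (Finset.univ.image fun v : V => {v}) := by
    intro E hE
    obtain ⟨v, -, rfl⟩ := Finset.mem_image.1 hE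
    have : Subsingleton (({v} : Finset V) : Set V) := by
      rw [Finset.coe_singleton]
      infer_instance
    exact { preconnected := SimpleGraph.Preconnected.of_subsingleton, nonempty := ⟨⟨v, by simp⟩⟩ }
  refine hS.le_gonality (fun C hC => ?_) fun A hA => ?_
  · have : C = Finset.univ := Finset.eq_univ_of_forall fun v => by
      simpa using hC {v} (by simp)
    rwa [this, Finset.card_univ]
  · obtain ⟨E₁, hE₁, E₂, hE₂, h1, h2⟩ := hA
    obtain ⟨⟨x, hx⟩⟩ := (hS E₁ hE₁).nonempty
    obtain ⟨⟨y, hy⟩⟩ := (hS E₂ hE₂).nonempty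
    exact hG.trans (G.edgeConnectivity_le ⟨x, h1 hx⟩ ⟨y, h2 hy⟩)

variable [Nontrivial W] {T : Multigraph W}

lemma exists_valence_complete_boxProd_eq (hT : T.IsTree) :
    ∃ a, ((complete V).boxProd T).valence a = Fintype.card V := by
  obtain ⟨t, ht⟩ := hT.exists_valence_eq_one
  refine ⟨(Classical.arbitrary V, t), ?_⟩
  rw [valence_boxProd, valence_complete, ht]
  have : 0 < Fintype.card V := Fintype.card_pos
  omega

lemma vertexConnectivity_complete_boxProd_tree (hT : T.IsTree) :
    ((complete V).boxProd T).vertexConnectivity = Fintype.card V := by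
  obtain ⟨a, ha⟩ := exists_valence_complete_boxProd_eq (V := V) hT
  exact le_antisymm (ha ▸ vertexConnectivity_le_valence _ a)
    (le_vertexConnectivity_complete_boxProd hT.1.1)

lemma edgeConnectivity_complete_boxProd_tree (hT : T.IsTree) :
    ((complete V).boxProd T).edgeConnectivity = Fintype.card V := by
  obtain ⟨a, ha⟩ := exists_valence_complete_boxProd_eq (V := V) hT
  exact le_antisymm (ha ▸ edgeConnectivity_le_valence _ a)
    (le_edgeConnectivity_complete_boxProd hT.1.1)

lemma gonality_complete_boxProd_tree (hT : T.IsTree) :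
    ((complete V).boxProd T).gonality = Fintype.card V := by
  refine le_antisymm ?_ (le_gonality_of_le_edgeConnectivity ?_
    (edgeConnectivity_complete_boxProd_tree hT).ge)
  · rw [gonality_boxProd_comm]
    -- With the tree as first factor, one chip goes into each of the `|V|` copies of `T`.
    exact (T.gonality_boxProd_le (complete V)).trans
      ((Nat.mul_le_mul_right _ hT.gonality_le_one).trans (one_mul _).le)
  · rw [Fintype.card_prod]
    exact Nat.le_mul_of_pos_right _ Fintype.card_pos

end CompleteTree

end Multigraph

theorem mainTheorem10 :
    (∀ (V : Type*) (W : Type*) [Fintype V] [Fintype W] (G : Multigraph V) (H : Multigraph W)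
        (k : ℕ),
      G.Connected → H.Connected →
      G.vertexConnectivity = k → G.edgeConnectivity = k → G.gonality = k →
      k ≤ H.edgeConnectivity →
      (Fintype.card W : ℤ) ≤ (Fintype.card V : ℤ) - 2 * (k : ℤ) + 4 →
      2 * (k : ℤ) - 1 ≤ (Fintype.card V : ℤ) →
      (k = 1 → Fintype.card W ≤ Fintype.card V * H.edgeConnectivity) →
      (G.boxProd H).scrambleNumber = k * Fintype.card W ∧
        (G.boxProd H).gonality = k * Fintype.card W) ∧
    (∀ (U : Type*) [Fintype U] (T : Multigraph U) (k l : ℕ),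
      T.IsTree → 2 ≤ Fintype.card U → 1 ≤ k → k < l →
      (l : ℤ) ≤ (k : ℤ) * ((Fintype.card U : ℤ) - 2) + 4 →
      ((Multigraph.complete (Fin l)).boxProd
          ((Multigraph.complete (Fin k)).boxProd T)).scrambleNumber = k * l ∧
        ((Multigraph.complete (Fin l)).boxProd
          ((Multigraph.complete (Fin k)).boxProd T)).gonality = k * l) := by
  refine ⟨?_, ?_⟩
  · intro V W _ _ G H k hGc hHc hκ hG hgon hH hm hn h1
    have : Nonempty V := hGc.nonempty
    have : Nonempty W := hHc.nonempty
    exact Multigraph.scrambleNumber_and_gonality_boxProd hκ hG hgon hH (by omega) (by omega) h1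
  · intro U _ T k l hT hU hk hkl hl
    have : Nontrivial U := Fintype.one_lt_card_iff_nontrivial.1 hU
    have : Nonempty (Fin k) := ⟨⟨0, hk⟩⟩
    have : Nontrivial (Fin l) := Fin.nontrivial_iff_two_le.2 (by omega)
    have hκ := Multigraph.vertexConnectivity_complete_boxProd_tree (V := Fin k) hT
    have hG := Multigraph.edgeConnectivity_complete_boxProd_tree (V := Fin k) hT
    have hgon := Multigraph.gonality_complete_boxProd_tree (V := Fin k) hT
    have hH := Multigraph.le_edgeConnectivity_complete (V := Fin l)
    rw [Fintype.card_fin] at hκ hG hgon hH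
    have hkU : k * 2 ≤ k * Fintype.card U := Nat.mul_le_mul_left _ hU
    have hl' : (l : ℤ) ≤ (k * Fintype.card U : ℕ) - 2 * k + 4 := by
      push_cast
      linarith
    rw [Multigraph.scrambleNumber_boxProd_comm, Multigraph.gonality_boxProd_comm]
    have := Multigraph.scrambleNumber_and_gonality_boxProd
      (H := Multigraph.complete (Fin l)) hκ hG hgon (by omega)
      (by simp only [Fintype.card_prod, Fintype.card_fin]; omega)
      (by simp only [Fintype.card_prod, Fintype.card_fin]; omega)
      -- The extra condition for `k = 1` holds because `T` has at least two vertices and `l ≥ 2`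
      -- gives `l ≤ 2 * (l - 1)`.
      (fun _ => by
        simp only [Fintype.card_prod, Fintype.card_fin]
        calc l ≤ 2 * (l - 1) := by omega
          _ ≤ _ := Nat.mul_le_mul (by omega) hH)
    simpa only [Fintype.card_fin] using this
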